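/- Let $f\in C^2(\mathbb R)$ with $f''(s)>0$ for all $s\in\mathbb R$ and $g\in C^1(\mathbb R)$ with $g'(s)>0$ for all $s\in\mathbb R$. For $\epsilon>0$ consider the viscous Hamer-type system $$\partial_t u+\partial_x f(u)-\epsilon\,\partial_{xx}u=\partial_x v,\qquad v-\partial_{xx}v=\partial_x g(u).$$ A propagating front with speed $c\in\mathbb R$ connecting $u_-$ to $u_+$ is a pair of profiles $u,v:\mathbb R\to\mathbb R$ such that $(t,x)\mapsto (u,v)(x-ct)$ is a classical ($C^2$) solution of the system on $\mathbb R\times\mathbb R$ and $(u,v)(\xi)\to(u_\pm,0)$ as $\xi\to\pm\infty$. There is $\delta_0>0$, depending only on $f$ and $g$, such that the following holds. Let $u_-\ne u_+$ be real numbers with $|u_+-u_-|<\delta_0$, let $$c=\frac{f(u_+)-f(u_-)}{u_+-u_-}$$ be the Rankine--Hugoniot speed, and assume the Lax condition $f'(u_+)<c<f'(u_-)$ (equivalently, $u_+<u_-$). Then, for every $\epsilon>0$, the system has a propagating front with speed $c$ connecting $u_-$ to $u_+$. In particular, for the viscous Hamer model $f(u)=\tfrac12u^2$, $g(u)=u$,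 there is $\delta_0>0$ such that whenever $u_+<u_-$ and $|u_+-u_-|<\delta_0$, for every $\epsilon>0$ (for instance $\epsilon=1$), there is a propagating front connecting $u_-$ to $u_+$ with speed $c=\tfrac12(u_++u_-)$. -/

import Mathlib

/-- The standing assumptions on the flux `f` and the coupling function `g`: `f` is of class `C²` with
positive second derivative, `g` is of class `C¹` with positive derivative. -/
structure IsHamerType (f g : ℝ → ℝ) : Prop where
  contDiff_f : ContDiff ℝ 2 f
  contDiff_g : ContDiff ℝ 1 g
  f_convex : ∀ s : ℝ, 0 < deriv (deriv f) s
  g_increasing : ∀ s : ℝ, 0 < deriv g s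

/-- The Rankine–Hugoniot speed of the jump between the states `uminus` and `uplus`. -/
noncomputable def rankineHugoniotSpeed (f : ℝ → ℝ) (uminus uplus : ℝ) : ℝ :=
  (f uplus - f uminus) / (uplus - uminus)

/-- The Lax condition for the jump from `uminus` to `uplus` with the Rankine–Hugoniot speed.
It fails for `uminus = uplus`. -/
def LaxCondition (f : ℝ → ℝ) (uminus uplus : ℝ) : Prop :=
  deriv f uplus < rankineHugoniotSpeed f uminus uplus ∧
    rankineHugoniotSpeed f uminus uplus < deriv f uminus

/-- `(U, V)`, written as functions of time and space in this order, is a classical solution on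
`ℝ × ℝ` of the viscous Hamer-type system
`∂ₜ U + ∂ₓ f(U) - ε ∂ₓₓ U = ∂ₓ V`, `V - ∂ₓₓ V = ∂ₓ g(U)`. -/
structure IsViscousHamerSolution (ε : ℝ) (f g : ℝ → ℝ) (U V : ℝ → ℝ → ℝ) : Prop where
  contDiff_fst : ContDiff ℝ 2 (fun p : ℝ × ℝ => U p.1 p.2)
  contDiff_snd : ContDiff ℝ 2 (fun p : ℝ × ℝ => V p.1 p.2)
  parabolic : ∀ t x : ℝ,
    deriv (fun s => U s x) t + deriv (fun y => f (U t y)) x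
      - ε * deriv (deriv (fun y => U t y)) x = deriv (fun y => V t y) x
  elliptic : ∀ t x : ℝ,
    V t x - deriv (deriv (fun y => V t y)) x = deriv (fun y => g (U t y)) x

/-- `(u, v; c)` is a propagating front of the viscous Hamer-type system connecting `uminus` (at `-∞`)
to `uplus` (at `+∞`): the travelling wave `(u, v)(x - c t)` solves the system, and
`(u, v)(±∞) = (u_±, 0)`. -/
structure IsPropagatingFront (ε : ℝ) (f g : ℝ → ℝ) (uminus uplus : ℝ) (u v : ℝ → ℝ) (c : ℝ) :
    Prop where
  solution : IsViscousHamerSolution ε f g (fun t x => u (x - c * t)) (fun t x => v (x - c * t))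
  u_atBot : Filter.Tendsto u Filter.atBot (nhds uminus)
  u_atTop : Filter.Tendsto u Filter.atTop (nhds uplus)
  v_atBot : Filter.Tendsto v Filter.atBot (nhds 0)
  v_atTop : Filter.Tendsto v Filter.atTop (nhds 0)

/-! Integrating the first equation once and writing `v = (b - a)/2`, with `a' = g(u) - a` and `b' =
b - g(u)`, turns fronts into heteroclinic orbits in ℝ³ with `ε u' = φ(u) + (a - b)/2`. Here `φ(s) =
f(s) - c s - κ` is strictly convex and vanishes exactly at the two end states.

This system is cooperative for the order in which `u` and `a - b` increase and `b` decreases.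
Differences of two orbits and velocities of one orbit both obey linear systems covered by
`cooperative_growth`, whose last component grows at least like `e^t` in the cone. So an orbit with
`b` bounded forward cannot have its velocity in the cone or its opposite with `b' ≠ 0`
(`not_mem_cone`), and such orbits are ordered (`bounded_orbit_le`).

Fix `u 0 = m` with `φ(m) < 0`. By connectedness each `a 0` admits a `b 0` keeping `b` bounded
forward, and `b 0` depends monotonically on `a 0`. The reflection gives the backward analogue, with
`a` and `b` exchanged. The monotone composite has a fixed point: an orbit with `b` bounded forward
and `a` bounded backward. Excluding the cones makes `u`, `a`, `b` nonincreasing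
(`exists_antitone_orbit`). Then `φ(u) ≤ 0`, which traps `u` between the end states, where the
truncation of `f` and `g` is invisible. Monotone limits are equilibria, and the position of `m`
tells which. -/

/-! ### Global flows of Lipschitz fields -/

open scoped Manifold in
/-- A `C¹` globally Lipschitz vector field has global integral curves. -/
theorem LipschitzWith.exists_global_integralCurve {E : Type*} [NormedAddCommGroup E]
    [NormedSpace ℝ E] [CompleteSpace E] {V : E → E} {K : NNReal} (hL : LipschitzWith K V)
    (hV : ContDiff ℝ 1 V) (x : E) :
    ∃ γ : ℝ → E, γ 0 = x ∧ ∀ t, HasDerivAt γ (V (γ t)) t := by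
  have hT : (0 : ℝ) < 1 / (K + 1) := by positivity
  have hloc : ∀ x : E, ∃ γ : ℝ → E, γ 0 = x ∧
      IsMIntegralCurveOn (I := 𝓘(ℝ, E)) γ (fun y => V y)
        (Set.Ioo (-(1 / ((K : ℝ) + 1))) (1 / ((K : ℝ) + 1))) := by
    intro x
    have h0 : (0 : ℝ) ∈ Set.Icc (-(1 / ((K : ℝ) + 1))) (1 / ((K : ℝ) + 1)) :=
      ⟨by linarith, hT.le⟩
    -- On the ball of radius `‖V x‖ + 1` the field grows at most to `‖V x‖ + K (‖V x‖ + 1)`, so the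
    -- existence time `1 / (K + 1)` does not depend on `x`; this uniformity gives global extension.
    have hPL : IsPicardLindelof (fun _ : ℝ => V) (⟨0, h0⟩ : Set.Icc (-(1 / ((K : ℝ) + 1)))
        (1 / ((K : ℝ) + 1))) x (‖V x‖₊ + 1) 0 (‖V x‖₊ + K * (‖V x‖₊ + 1)) K := by
      refine ⟨fun _ _ => hL.lipschitzOnWith, fun _ _ => continuousOn_const, ?_, ?_⟩
      · intro t _ y hy
        have h1 : ‖V y - V x‖ ≤ K * ‖y - x‖ := by
          simpa [dist_eq_norm] using hL.dist_le_mul y x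
        have h2 : ‖y - x‖ ≤ ‖V x‖ + 1 := by
          simpa [dist_eq_norm] using hy
        have h3 : ‖V y‖ ≤ ‖V x‖ + ‖V y - V x‖ := by
          calc ‖V y‖ = ‖V x + (V y - V x)‖ := by congr 1; abel
            _ ≤ _ := norm_add_le _ _
        have h4 : (K : ℝ) * ‖y - x‖ ≤ K * (‖V x‖ + 1) :=
          mul_le_mul_of_nonneg_left h2 K.2
        push_cast
        linarith
      · push_cast
        simp only [sub_zero, zero_sub, neg_neg, max_self]
        rw [mul_one_div, div_le_iff₀ (by positivity)]
        nlinarith [norm_nonneg (V x), K.2]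
    obtain ⟨γ, h1, h2⟩ := hPL.exists_eq_forall_mem_Icc_hasDerivWithinAt₀
    refine ⟨γ, h1, fun t ht => ?_⟩
    have h3 := (h2 t (Set.Ioo_subset_Icc_self ht)).mono Set.Ioo_subset_Icc_self
    exact h3.hasFDerivWithinAt.hasMFDerivWithinAt
  have hV' : ContMDiff 𝓘(ℝ, E) (𝓘(ℝ, E).prod 𝓘(ℝ, E)) 1
      (fun x => (⟨x, V x⟩ : TangentBundle 𝓘(ℝ, E) E)) :=
    contMDiff_vectorSpace_iff_contDiff.2 hV
  obtain ⟨γ, h1, h2⟩ := exists_isMIntegralCurve_of_isMIntegralCurveOn hV' hT hloc x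
  refine ⟨γ, h1, fun t => ?_⟩
  have h3 : HasFDerivAt γ ((1 : ℝ →L[ℝ] ℝ).smulRight (V (γ t))) t := (h2 t).hasFDerivAt
  simpa using h3.hasDerivAt

/-! ### Cooperative linear systems -/

/-- Extending a function with vanishing derivative at `0` by `0` to the positive half-line. -/
theorem HasDerivAt.comp_min_zero {f f' : ℝ → ℝ} (hf : ∀ s, HasDerivAt f (f' s) s)
    (h0 : f 0 = 0) (h0' : f' 0 = 0) (s : ℝ) :
    HasDerivAt (fun x => f (min x 0)) (f' (min s 0)) s := by
  rcases lt_trichotomy s 0 with hs | rfl | hs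
  · rw [min_eq_left hs.le]
    refine (hf s).congr_of_eventuallyEq ?_
    filter_upwards [Iio_mem_nhds hs] with x hx
    rw [min_eq_left (le_of_lt hx)]
  · rw [min_self, h0']
    have h1 : (fun x => f x) =o[nhds 0] (fun x : ℝ => x) := by
      have := hasDerivAt_iff_isLittleO.1 (hf 0)
      simpa [h0, h0'] using this
    have h2 : Filter.Tendsto (fun x : ℝ => min x 0) (nhds 0) (nhds 0) := by
      have : Continuous fun x : ℝ => min x 0 := by fun_prop
      simpa using this.tendsto 0
    have h3 : (fun x : ℝ => f (min x 0)) =o[nhds 0] (fun x : ℝ => x) := by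
      refine (h1.comp_tendsto h2).trans_isBigO (Asymptotics.IsBigO.of_bound 1 ?_)
      filter_upwards with x
      simp only [Function.comp, Real.norm_eq_abs, one_mul]
      rcases le_total x 0 with hx | hx
      · rw [min_eq_left hx]
      · rw [min_eq_right hx]; simp
    rw [hasDerivAt_iff_isLittleO]
    simpa [h0] using h3
  · rw [min_eq_right hs.le, h0']
    refine (hasDerivAt_const s (0 : ℝ)).congr_of_eventuallyEq ?_
    filter_upwards [Ioi_mem_nhds hs] with x hx
    rw [min_eq_right (le_of_lt hx), h0]

/-- Squaring removes the corner of the negative part, so that it can enter a differentiable energy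
in `cooperative_growth`. -/
theorem HasDerivAt.sq_min_zero {x : ℝ → ℝ} {x' t : ℝ} (hx : HasDerivAt x x' t) :
    HasDerivAt (fun s => min (x s) 0 ^ 2) (2 * min (x t) 0 * x') t := by
  have h := HasDerivAt.comp_min_zero (f := fun s => s ^ 2) (f' := fun s => 2 * s)
    (fun s => by simpa using hasDerivAt_pow 2 s) (by simp) (by simp) (x t)
  exact h.comp t hx

/-- The nonnegative cone is forward invariant under the cooperative linear system
`x' = c x + k y`, `y' = 2 γ x - y + 2 z`, `z' = z + γ x`, and `z` grows exponentially there. -/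
theorem cooperative_growth {x y z c γ : ℝ → ℝ} {k C t₀ : ℝ} (hk : 0 ≤ k)
    (hc : ∀ t, c t ≤ C) (hγ₀ : ∀ t, 0 ≤ γ t) (hγC : ∀ t, γ t ≤ C)
    (hx : ∀ t, HasDerivAt x (c t * x t + k * y t) t)
    (hy : ∀ t, HasDerivAt y (2 * γ t * x t - y t + 2 * z t) t)
    (hz : ∀ t, HasDerivAt z (z t + γ t * x t) t)
    (hx₀ : 0 ≤ x t₀) (hy₀ : 0 ≤ y t₀) (hz₀ : 0 < z t₀) (M : ℝ) :
    ∃ t, t₀ ≤ t ∧ M < z t := by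
  -- `D` dominates the coefficients of all three squares in the estimates `e1`, `e2`, `e3`, so the
  -- energy of the negative parts, weighted by `exp (-D t)`, cannot increase; it vanishes at `t₀`.
  set D := 5 * C + k + 4 with hD
  have hEanti : Antitone (fun t => (min (x t) 0 ^ 2 + min (y t) 0 ^ 2 + min (z t) 0 ^ 2)
      * Real.exp (-(D * t))) := by
    refine antitone_of_hasDerivAt_nonpos (fun t => (((hx t).sq_min_zero.add
      (hy t).sq_min_zero).add (hz t).sq_min_zero).mul
        ((((hasDerivAt_id t).const_mul D).neg).exp)) (fun t => ?_)
    have hexp := Real.exp_pos (-(D * t))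
    have key : ∀ s : ℝ, min s 0 ≤ 0 ∧ min s 0 ≤ s ∧ min s 0 * s = min s 0 ^ 2 := by
      intro s
      rcases le_total s 0 with h | h
      · rw [min_eq_left h]; exact ⟨h, le_rfl, by ring⟩
      · rw [min_eq_right h]; exact ⟨le_rfl, h, by ring⟩
    obtain ⟨a1, a2, a3⟩ := key (x t)
    obtain ⟨b1, b2, b3⟩ := key (y t)
    obtain ⟨d1, d2, d3⟩ := key (z t)
    simp only [Pi.add_apply, Pi.neg_apply, id]
    generalize min (x t) 0 = m at *
    generalize min (y t) 0 = n at *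
    generalize min (z t) 0 = l at *
    have hC : 0 ≤ C := (hγ₀ t).trans (hγC t)
    have g0 := hγ₀ t
    have g1 := hγC t
    have c1 := hc t
    generalize γ t = G at *
    generalize c t = Q at *
    have e1 : 2 * m * (Q * x t + k * y t) ≤ 2 * C * m ^ 2 + k * (m ^ 2 + n ^ 2) := by
      have : 2 * m * (Q * x t + k * y t) = 2 * Q * m ^ 2 + 2 * k * (m * y t) := by
        rw [← a3]; ring
      have h1 : m * y t ≤ m * n := mul_le_mul_of_nonpos_left b2 a1
      have h2 : k * (m * y t) ≤ k * (m * n) := mul_le_mul_of_nonneg_left h1 hk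
      have h3 : Q * m ^ 2 ≤ C * m ^ 2 := mul_le_mul_of_nonneg_right c1 (sq_nonneg _)
      nlinarith [mul_nonneg hk (sq_nonneg (m - n))]
    have e2 : 2 * n * (2 * G * x t - y t + 2 * z t)
        ≤ 2 * C * (m ^ 2 + n ^ 2) + 2 * (n ^ 2 + l ^ 2) := by
      have : 2 * n * (2 * G * x t - y t + 2 * z t)
          = 4 * (G * (n * x t)) - 2 * n ^ 2 + 4 * (n * z t) := by
        rw [← b3]; ring
      have h1 : n * x t ≤ n * m := mul_le_mul_of_nonpos_left a2 b1
      have h2 : n * z t ≤ n * l := mul_le_mul_of_nonpos_left d2 b1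
      have h3 : G * (n * x t) ≤ G * (n * m) := mul_le_mul_of_nonneg_left h1 g0
      have h4 : G * (n * m) ≤ C * (n * m) :=
        mul_le_mul_of_nonneg_right g1 (mul_nonneg_of_nonpos_of_nonpos b1 a1)
      nlinarith [mul_nonneg hC (sq_nonneg (m - n)), sq_nonneg (n - l), sq_nonneg n]
    have e3 : 2 * l * (z t + G * x t) ≤ 2 * l ^ 2 + C * (m ^ 2 + l ^ 2) := by
      have : 2 * l * (z t + G * x t) = 2 * l ^ 2 + 2 * (G * (l * x t)) := by
        rw [← d3]; ring
      have h1 : l * x t ≤ l * m := mul_le_mul_of_nonpos_left a2 d1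
      have h3 : G * (l * x t) ≤ G * (l * m) := mul_le_mul_of_nonneg_left h1 g0
      have h4 : G * (l * m) ≤ C * (l * m) :=
        mul_le_mul_of_nonneg_right g1 (mul_nonneg_of_nonpos_of_nonpos d1 a1)
      nlinarith [mul_nonneg hC (sq_nonneg (m - l))]
    have e4 : 2 * m * (Q * x t + k * y t) + 2 * n * (2 * G * x t - y t + 2 * z t)
        + 2 * l * (z t + G * x t) - D * (m ^ 2 + n ^ 2 + l ^ 2) ≤ 0 := by
      rw [hD]
      nlinarith [mul_nonneg hC (sq_nonneg m), mul_nonneg hC (sq_nonneg n),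
        mul_nonneg hC (sq_nonneg l), mul_nonneg hk (sq_nonneg l), sq_nonneg m, sq_nonneg n,
        sq_nonneg l]
    calc _ = (2 * m * (Q * x t + k * y t) + 2 * n * (2 * G * x t - y t + 2 * z t)
        + 2 * l * (z t + G * x t) - D * (m ^ 2 + n ^ 2 + l ^ 2)) * Real.exp (-(D * t)) := by ring
      _ ≤ 0 := mul_nonpos_of_nonpos_of_nonneg e4 hexp.le
  have hxpos : ∀ t, t₀ ≤ t → 0 ≤ x t := by
    intro t ht
    have h := hEanti ht
    simp only [min_eq_right hx₀, min_eq_right hy₀, min_eq_right hz₀.le] at h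
    have h1 : min (x t) 0 ^ 2 + min (y t) 0 ^ 2 + min (z t) 0 ^ 2 ≤ 0 := by
      by_contra hcon
      have := mul_pos (not_le.1 hcon) (Real.exp_pos (-(D * t)))
      simp at h
      linarith
    have h2 : min (x t) 0 = 0 := by
      have : min (x t) 0 ^ 2 = 0 := by
        nlinarith [sq_nonneg (min (x t) 0), sq_nonneg (min (y t) 0), sq_nonneg (min (z t) 0)]
      simpa using this
    exact min_eq_right_iff.1 h2
  have hmono : MonotoneOn (fun t => z t * Real.exp (-t)) (Set.Ici t₀) := by
    have hd : ∀ t, HasDerivAt (fun t => z t * Real.exp (-t))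
        ((z t + γ t * x t) * Real.exp (-t) + z t * (Real.exp (-t) * (-1))) t := fun t =>
      (hz t).mul ((hasDerivAt_id t).neg.exp)
    refine monotoneOn_of_deriv_nonneg (convex_Ici _)
      (fun t _ => (hd t).continuousAt.continuousWithinAt)
      (fun t _ => (hd t).differentiableAt.differentiableWithinAt) (fun t ht => ?_)
    rw [(hd t).deriv]
    rw [interior_Ici] at ht
    have := mul_nonneg (mul_nonneg (hγ₀ t) (hxpos t (le_of_lt ht))) (Real.exp_pos (-t)).le
    linarith
  have hA : 0 < z t₀ * Real.exp (-t₀) := mul_pos hz₀ (Real.exp_pos _)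
  have hlim : Filter.Tendsto (fun t => z t₀ * Real.exp (-t₀) * Real.exp t) Filter.atTop
      Filter.atTop := Real.tendsto_exp_atTop.const_mul_atTop hA
  obtain ⟨t, ht1, ht2⟩ := ((hlim.eventually_gt_atTop M).and
    (Filter.eventually_ge_atTop t₀)).exists
  refine ⟨t, ht2, ht1.trans_le ?_⟩
  have h := hmono Set.self_mem_Ici (Set.mem_Ici.2 ht2) ht2
  calc _ ≤ z t * Real.exp (-t) * Real.exp t :=
        mul_le_mul_of_nonneg_right h (Real.exp_pos t).le
    _ = z t := by rw [mul_assoc, ← Real.exp_add]; simp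

/-! ### The truncated travelling wave system and its reflection -/

/-- Globally defined nonlinearities `F`, `g` of class `C¹` with bounded derivatives, where `g` is
nondecreasing with values in `(L, H)`. -/
structure IsTruncatedFlux (F g : ℝ → ℝ) (C L H : ℝ) : Prop where
  contDiff_F : ContDiff ℝ 1 F
  contDiff_g : ContDiff ℝ 1 g
  abs_deriv_F_le : ∀ s, |deriv F s| ≤ C
  deriv_g_nonneg : ∀ s, 0 ≤ deriv g s
  deriv_g_le : ∀ s, deriv g s ≤ C
  lt_g : ∀ s, L < g s
  g_lt : ∀ s, g s < H

/-- Trajectories of the travelling wave system, where `a` and `b` are the two one-sided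
exponential averages of `g(u)`. -/
structure IsOrbit (ε : ℝ) (F g u a b : ℝ → ℝ) : Prop where
  hasDerivAt_u : ∀ t, HasDerivAt u ((F (u t) + (a t - b t) / 2) / ε) t
  hasDerivAt_a : ∀ t, HasDerivAt a (g (u t) - a t) t
  hasDerivAt_b : ∀ t, HasDerivAt b (b t - g (u t)) t

/-- The vector field of the travelling wave system. -/
noncomputable def waveField (ε : ℝ) (F g : ℝ → ℝ) (x : ℝ × ℝ × ℝ) : ℝ × ℝ × ℝ :=
  ((F x.1 + (x.2.1 - x.2.2) / 2) / ε, g x.1 - x.2.1, x.2.2 - g x.1)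

theorem IsOrbit.hasDerivAt_prod {ε : ℝ} {F g u a b : ℝ → ℝ} (h : IsOrbit ε F g u a b) (t : ℝ) :
    HasDerivAt (fun t => (u t, a t, b t)) (waveField ε F g (u t, a t, b t)) t :=
  (h.hasDerivAt_u t).prodMk ((h.hasDerivAt_a t).prodMk (h.hasDerivAt_b t))

/-- The reflection `(u, a, b)(t) ↦ (-u, -b, -a)(-t)`. -/
theorem IsOrbit.reflect {ε : ℝ} {F g u a b : ℝ → ℝ} (h : IsOrbit ε F g u a b) :
    IsOrbit ε (fun s => F (-s)) (fun s => -g (-s)) (fun t => -u (-t)) (fun t => -b (-t))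
      (fun t => -a (-t)) := by
  refine ⟨fun t => ?_, fun t => ?_, fun t => ?_⟩
  · refine (((h.hasDerivAt_u (-t)).scomp t (hasDerivAt_neg t)).neg).congr_deriv ?_
    simp; ring
  · refine (((h.hasDerivAt_b (-t)).scomp t (hasDerivAt_neg t)).neg).congr_deriv ?_
    simp; ring
  · refine (((h.hasDerivAt_a (-t)).scomp t (hasDerivAt_neg t)).neg).congr_deriv ?_
    simp; ring

namespace IsTruncatedFlux

variable {F g : ℝ → ℝ} {C L H ε : ℝ}

theorem reflect (h : IsTruncatedFlux F g C L H) :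
    IsTruncatedFlux (fun s => F (-s)) (fun s => -g (-s)) C (-H) (-L) where
  contDiff_F := h.contDiff_F.comp contDiff_neg
  contDiff_g := (h.contDiff_g.comp contDiff_neg).neg
  abs_deriv_F_le s := by rw [deriv_comp_neg, abs_neg]; exact h.abs_deriv_F_le _
  deriv_g_nonneg s := by
    rw [deriv.fun_neg, deriv_comp_neg, neg_neg]; exact h.deriv_g_nonneg _
  deriv_g_le s := by
    rw [deriv.fun_neg, deriv_comp_neg, neg_neg]; exact h.deriv_g_le _
  lt_g s := neg_lt_neg (h.g_lt _)
  g_lt s := neg_lt_neg (h.lt_g _)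

theorem hasDerivAt_F (h : IsTruncatedFlux F g C L H) (s : ℝ) : HasDerivAt F (deriv F s) s :=
  (h.contDiff_F.differentiable one_ne_zero s).hasDerivAt

theorem hasDerivAt_g (h : IsTruncatedFlux F g C L H) (s : ℝ) : HasDerivAt g (deriv g s) s :=
  (h.contDiff_g.differentiable one_ne_zero s).hasDerivAt

theorem lt (h : IsTruncatedFlux F g C L H) : L < H := (h.lt_g 0).trans (h.g_lt 0)

theorem nonneg (h : IsTruncatedFlux F g C L H) : 0 ≤ C :=
  (h.deriv_g_nonneg 0).trans (h.deriv_g_le 0)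

theorem monotone_g (h : IsTruncatedFlux F g C L H) : Monotone g :=
  monotone_of_deriv_nonneg (h.contDiff_g.differentiable one_ne_zero) h.deriv_g_nonneg

theorem abs_F_sub_le (h : IsTruncatedFlux F g C L H) (s t : ℝ) : |F t - F s| ≤ C * |t - s| := by
  have := Convex.norm_image_sub_le_of_norm_deriv_le (f := F) (C := C) (s := Set.univ)
    (fun x _ => h.contDiff_F.differentiable one_ne_zero x)
    (fun x _ => h.abs_deriv_F_le x) convex_univ (Set.mem_univ s) (Set.mem_univ t)
  simpa using this

theorem abs_g_sub_le (h : IsTruncatedFlux F g C L H) (s t : ℝ) : |g t - g s| ≤ C * |t - s| := by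
  have := Convex.norm_image_sub_le_of_norm_deriv_le (f := g) (C := C) (s := Set.univ)
    (fun x _ => h.contDiff_g.differentiable one_ne_zero x)
    (fun x _ => by
      rw [Real.norm_eq_abs, abs_of_nonneg (h.deriv_g_nonneg x)]; exact h.deriv_g_le x)
    convex_univ (Set.mem_univ s) (Set.mem_univ t)
  simpa using this

/-- Difference quotients of `F` and `g`. -/
theorem exists_quotient (h : IsTruncatedFlux F g C L H) (s t : ℝ) :
    ∃ c γ : ℝ, F t - F s = c * (t - s) ∧ g t - g s = γ * (t - s) ∧ c ≤ C ∧ 0 ≤ γ ∧ γ ≤ C := by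
  rcases eq_or_ne t s with rfl | hne
  · exact ⟨0, 0, by simp, by simp, h.nonneg, le_rfl, h.nonneg⟩
  have hne' : t - s ≠ 0 := sub_ne_zero.2 hne
  have hpos : 0 < |t - s| := abs_pos.2 hne'
  refine ⟨(F t - F s) / (t - s), (g t - g s) / (t - s), by field_simp, by field_simp, ?_, ?_, ?_⟩
  · refine (le_abs_self _).trans ?_
    rw [abs_div, div_le_iff₀ hpos]
    exact h.abs_F_sub_le s t
  · rcases lt_or_gt_of_ne hne with hlt | hlt
    · exact div_nonneg_of_nonpos (sub_nonpos.2 (h.monotone_g hlt.le)) (by linarith)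
    · exact div_nonneg (sub_nonneg.2 (h.monotone_g hlt.le)) (by linarith)
  · refine (le_abs_self _).trans ?_
    rw [abs_div, div_le_iff₀ hpos]
    exact h.abs_g_sub_le s t

theorem exists_lipschitzWith (h : IsTruncatedFlux F g C L H) (ε : ℝ) :
    ∃ K, LipschitzWith K (waveField ε F g) := by
  have hF : LipschitzWith ⟨C, h.nonneg⟩ F := LipschitzWith.of_dist_le_mul fun x y => by
    rw [Real.dist_eq, Real.dist_eq]; exact h.abs_F_sub_le y x
  have hg : LipschitzWith ⟨C, h.nonneg⟩ g := LipschitzWith.of_dist_le_mul fun x y => by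
    rw [Real.dist_eq, Real.dist_eq]; exact h.abs_g_sub_le y x
  have h1 : LipschitzWith 1 (fun x : ℝ × ℝ × ℝ => x.1) := LipschitzWith.prod_fst
  have h2 : LipschitzWith (1 * 1) (fun x : ℝ × ℝ × ℝ => x.2.1) :=
    LipschitzWith.prod_fst.comp (LipschitzWith.prod_snd (α := ℝ) (β := ℝ × ℝ))
  have h3 : LipschitzWith (1 * 1) (fun x : ℝ × ℝ × ℝ => x.2.2) :=
    LipschitzWith.prod_snd.comp (LipschitzWith.prod_snd (α := ℝ) (β := ℝ × ℝ))
  have hab := (lipschitzWith_smul (2⁻¹ : ℝ)).comp (h2.sub h3)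
  have hu := (lipschitzWith_smul (ε⁻¹ : ℝ)).comp ((hF.comp h1).add hab)
  have hw : waveField ε F g = fun x => (((fun y : ℝ => ε⁻¹ • y) ∘ fun x : ℝ × ℝ × ℝ =>
      (F ∘ fun x => x.1) x + ((fun y : ℝ => (2⁻¹ : ℝ) • y) ∘ fun x : ℝ × ℝ × ℝ =>
        x.2.1 - x.2.2) x) x, (g ∘ fun x => x.1) x - x.2.1, x.2.2 - (g ∘ fun x => x.1) x) := by
    funext x
    simp only [waveField, Function.comp, smul_eq_mul]
    rw [div_eq_inv_mul, div_eq_inv_mul]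
  exact ⟨_, hw ▸ hu.prodMk (((hg.comp h1).sub h2).prodMk (h3.sub (hg.comp h1)))⟩

theorem contDiff_waveField (h : IsTruncatedFlux F g C L H) (ε : ℝ) :
    ContDiff ℝ 1 (waveField ε F g) := by
  have hF := h.contDiff_F
  have hg := h.contDiff_g
  unfold waveField
  fun_prop

theorem exists_isOrbit (h : IsTruncatedFlux F g C L H) (ε m α β : ℝ) :
    ∃ u a b : ℝ → ℝ, IsOrbit ε F g u a b ∧ u 0 = m ∧ a 0 = α ∧ b 0 = β := by
  obtain ⟨K, hK⟩ := h.exists_lipschitzWith ε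
  obtain ⟨γ, h0, hγ⟩ := hK.exists_global_integralCurve (h.contDiff_waveField ε) (m, α, β)
  refine ⟨fun t => (γ t).1, fun t => (γ t).2.1, fun t => (γ t).2.2, ⟨fun t => ?_, fun t => ?_,
    fun t => ?_⟩, by simp [h0], by simp [h0], by simp [h0]⟩
  · exact (hasFDerivAt_fst.comp_hasDerivAt t (hγ t))
  · exact (hasFDerivAt_fst.comp_hasDerivAt t (hasFDerivAt_snd.comp_hasDerivAt t (hγ t)))
  · exact (hasFDerivAt_snd.comp_hasDerivAt t (hasFDerivAt_snd.comp_hasDerivAt t (hγ t)))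

theorem isOrbit_unique (h : IsTruncatedFlux F g C L H) {u₁ a₁ b₁ u₂ a₂ b₂ : ℝ → ℝ}
    (h₁ : IsOrbit ε F g u₁ a₁ b₁) (h₂ : IsOrbit ε F g u₂ a₂ b₂) {t₀ : ℝ}
    (hu : u₁ t₀ = u₂ t₀) (ha : a₁ t₀ = a₂ t₀) (hb : b₁ t₀ = b₂ t₀) :
    u₁ = u₂ ∧ a₁ = a₂ ∧ b₁ = b₂ := by
  obtain ⟨K, hK⟩ := h.exists_lipschitzWith ε
  have := ODE_solution_unique_univ (v := fun _ => waveField ε F g) (s := fun _ => Set.univ)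
    (K := K) (t₀ := t₀) (fun t => hK.lipschitzOnWith)
    (fun t => ⟨h₁.hasDerivAt_prod t, trivial⟩) (fun t => ⟨h₂.hasDerivAt_prod t, trivial⟩)
    (by simp [hu, ha, hb])
  have key := fun t => congrFun this t
  simp only [Prod.mk.injEq] at key
  exact ⟨funext fun t => (key t).1, funext fun t => (key t).2.1, funext fun t => (key t).2.2⟩

/-! ### Order cones and divergence -/

/-- Two ordered orbits with distinct values of `b` diverge. -/
theorem exists_lt_sub_of_ordered (h : IsTruncatedFlux F g C L H) (hε : 0 < ε)
    {u₁ a₁ b₁ u₂ a₂ b₂ : ℝ → ℝ}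
    (h₁ : IsOrbit ε F g u₁ a₁ b₁) (h₂ : IsOrbit ε F g u₂ a₂ b₂) {t₀ : ℝ}
    (hu : u₁ t₀ ≤ u₂ t₀) (hab : a₁ t₀ - b₁ t₀ ≤ a₂ t₀ - b₂ t₀) (hb : b₂ t₀ < b₁ t₀) (M : ℝ) :
    ∃ t, t₀ ≤ t ∧ M < b₁ t - b₂ t := by
  choose c γ hc hγ hcC hγ0 hγC using fun t => h.exists_quotient (u₁ t) (u₂ t)
  have hC := h.nonneg
  refine cooperative_growth (x := fun t => u₂ t - u₁ t)
    (y := fun t => (a₂ t - b₂ t) - (a₁ t - b₁ t)) (z := fun t => b₁ t - b₂ t)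
    (c := fun t => c t / ε) (γ := γ) (k := 1 / (2 * ε)) (C := max C (C / ε)) (by positivity)
    (fun t => le_max_of_le_right (div_le_div_of_nonneg_right (hcC t) hε.le)) hγ0
    (fun t => le_max_of_le_left (hγC t)) (fun t => ?_) (fun t => ?_) (fun t => ?_)
    (sub_nonneg.2 hu) (sub_nonneg.2 hab) (sub_pos.2 hb) M
  · refine ((h₂.hasDerivAt_u t).sub (h₁.hasDerivAt_u t)).congr_deriv ?_
    have := hc t
    field_simp
    linear_combination 2 * this
  · refine (((h₂.hasDerivAt_a t).sub (h₂.hasDerivAt_b t)).sub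
      ((h₁.hasDerivAt_a t).sub (h₁.hasDerivAt_b t))).congr_deriv ?_
    linear_combination 2 * hγ t
  · refine ((h₁.hasDerivAt_b t).sub (h₂.hasDerivAt_b t)).congr_deriv ?_
    linear_combination hγ t

/-- If the velocity of an orbit lies in one of the two opposite order cones then `b` is unbounded. -/
theorem exists_lt_deriv_of_cone (h : IsTruncatedFlux F g C L H) (hε : 0 < ε)
    {u a b : ℝ → ℝ} (ho : IsOrbit ε F g u a b) {t₀ σ : ℝ}
    (hp : 0 ≤ σ * (F (u t₀) + (a t₀ - b t₀) / 2))
    (hq : σ * (b t₀ - g (u t₀)) ≤ σ * (g (u t₀) - a t₀)) (hr : σ * (b t₀ - g (u t₀)) < 0)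
    (M : ℝ) : ∃ t, t₀ ≤ t ∧ M < -(σ * (b t - g (u t))) := by
  have hC := h.nonneg
  have hFu := fun t => (h.hasDerivAt_F (u t)).comp t (ho.hasDerivAt_u t)
  have hgu := fun t => (h.hasDerivAt_g (u t)).comp t (ho.hasDerivAt_u t)
  refine cooperative_growth (x := fun t => σ * ((F (u t) + (a t - b t) / 2) / ε))
    (y := fun t => σ * (2 * g (u t) - a t - b t)) (z := fun t => -(σ * (b t - g (u t))))
    (c := fun t => deriv F (u t) / ε) (γ := fun t => deriv g (u t)) (k := 1 / (2 * ε))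
    (C := max C (C / ε)) (by positivity)
    (fun t => le_max_of_le_right (div_le_div_of_nonneg_right
      ((le_abs_self _).trans (h.abs_deriv_F_le _)) hε.le)) (fun t => h.deriv_g_nonneg _)
    (fun t => le_max_of_le_left (h.deriv_g_le _)) (fun t => ?_) (fun t => ?_) (fun t => ?_)
    ?_ ?_ ?_ M
  · refine ((((hFu t).add (((ho.hasDerivAt_a t).sub (ho.hasDerivAt_b t)).div_const 2)).div_const
      ε).const_mul σ).congr_deriv ?_
    field_simp
    ring
  · refine (((((hgu t).const_mul 2).sub (ho.hasDerivAt_a t)).sub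
      (ho.hasDerivAt_b t)).const_mul σ).congr_deriv ?_
    ring
  · refine ((((ho.hasDerivAt_b t).sub (hgu t)).const_mul σ).neg).congr_deriv ?_
    ring
  · rw [← mul_div_assoc]; exact div_nonneg hp hε.le
  · nlinarith
  · linarith

/-- Otherwise `b' = b - g(u)` would be unbounded, although `b` and `g(u)` both stay in `[L, H]`. The
sign `σ` treats the cone and its opposite together. -/
theorem not_mem_cone (h : IsTruncatedFlux F g C L H) (hε : 0 < ε)
    {u a b : ℝ → ℝ} (ho : IsOrbit ε F g u a b) (hb : ∀ t, 0 ≤ t → b t ∈ Set.Icc L H)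
    {t₀ σ : ℝ} (ht₀ : 0 ≤ t₀) (hp : 0 ≤ σ * (F (u t₀) + (a t₀ - b t₀) / 2))
    (hq : σ * (b t₀ - g (u t₀)) ≤ σ * (g (u t₀) - a t₀)) : 0 ≤ σ * (b t₀ - g (u t₀)) := by
  by_contra! hr
  obtain ⟨t, ht, hlt⟩ := h.exists_lt_deriv_of_cone hε ho hp hq hr (|σ| * (H - L))
  have h1 := hb t (ht₀.trans ht)
  have h2 : |b t - g (u t)| ≤ H - L := by
    rw [abs_le]
    constructor <;> linarith [h1.1, h1.2, h.lt_g (u t), h.g_lt (u t)]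
  have h3 : -(σ * (b t - g (u t))) ≤ |σ| * |b t - g (u t)| := by
    rw [← abs_mul]; exact neg_le_abs _
  nlinarith [abs_nonneg σ]

end IsTruncatedFlux

/-! ### Shooting for forward bounded orbits -/

namespace IsTruncatedFlux

variable {F g : ℝ → ℝ} {C L H ε : ℝ}

/-- For every `m` and `α` some choice of `b 0` keeps `b` bounded for positive times. -/
theorem exists_bounded_orbit (h : IsTruncatedFlux F g C L H) (ε m α : ℝ) :
    ∃ u a b : ℝ → ℝ, IsOrbit ε F g u a b ∧ u 0 = m ∧ a 0 = α ∧
      ∀ t, 0 ≤ t → b t ∈ Set.Icc L H := by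
  choose u a b ho hu ha hb using fun β => h.exists_isOrbit ε m α β
  obtain ⟨K, hK⟩ := h.exists_lipschitzWith ε
  have hcont : ∀ t, 0 ≤ t → Continuous fun β => b β t := by
    intro t ht
    have hlip : ∀ β β', dist (b β t) (b β' t) ≤ Real.exp (K * (t - 0)) * dist β β' := by
      intro β β'
      have h1 := dist_le_of_trajectories_ODE (v := fun _ => waveField ε F g) (K := K)
        (f := fun t => (u β t, a β t, b β t)) (g := fun t => (u β' t, a β' t, b β' t))
        (a := 0) (b := t) (δ := dist β β') (fun _ => hK)
        (fun s _ => ((ho β).hasDerivAt_prod s).continuousAt.continuousWithinAt)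
        (fun s _ => ((ho β).hasDerivAt_prod s).hasDerivWithinAt)
        (fun s _ => ((ho β').hasDerivAt_prod s).continuousAt.continuousWithinAt)
        (fun s _ => ((ho β').hasDerivAt_prod s).hasDerivWithinAt)
        (by simp [Prod.dist_eq, hu, ha, hb]) t ⟨ht, le_rfl⟩
      rw [mul_comm]
      refine le_trans ?_ h1
      exact (le_max_right _ _).trans (le_max_right _ _)
    exact (LipschitzWith.of_dist_le_mul (K := ⟨_, (Real.exp_pos (K * (t - 0))).le⟩)
      hlip).continuous
  -- With `b' = b - g(u)` and `L < g < H`, leaving `[L, H]` on either side is irreversible; the two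
  -- exit sets of initial values are therefore disjoint, besides being open.
  have hL : ∀ β, Antitone fun t => (b β t - L) * Real.exp (-t) := fun β =>
    antitone_of_hasDerivAt_nonpos (fun t => (((ho β).hasDerivAt_b t).sub_const L).mul
      (hasDerivAt_id t).neg.exp) fun t => by
        have := mul_pos (sub_pos.2 (h.lt_g (u β t))) (Real.exp_pos (-t))
        simp only [Pi.neg_apply, id, Pi.zero_apply]
        linarith
  have hH : ∀ β, Monotone fun t => (b β t - H) * Real.exp (-t) := fun β =>
    monotone_of_hasDerivAt_nonneg (fun t => (((ho β).hasDerivAt_b t).sub_const H).mul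
      (hasDerivAt_id t).neg.exp) fun t => by
        have := mul_pos (sub_pos.2 (h.g_lt (u β t))) (Real.exp_pos (-t))
        simp only [Pi.neg_apply, id, Pi.zero_apply]
        linarith
  have hlow : ∀ β s t, s ≤ t → b β s < L → b β t < L := by
    intro β s t hst hs
    have h1 := hL β hst
    have h2 := mul_neg_of_neg_of_pos (sub_neg.2 hs) (Real.exp_pos (-s))
    exact sub_neg.1 (neg_of_mul_neg_left (lt_of_le_of_lt h1 h2) (Real.exp_pos _).le)
  have hhigh : ∀ β s t, s ≤ t → H < b β s → H < b β t := by
    intro β s t hst hs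
    have h1 := hH β hst
    have h2 := mul_pos (sub_pos.2 hs) (Real.exp_pos (-s))
    exact sub_pos.1 (pos_of_mul_pos_left (lt_of_lt_of_le h2 h1) (Real.exp_pos _).le)
  let P : Set ℝ := {β | ∃ t, 0 ≤ t ∧ b β t < L}
  let N : Set ℝ := {β | ∃ t, 0 ≤ t ∧ H < b β t}
  have hP : IsOpen P := by
    have : P = ⋃ t : Set.Ici (0 : ℝ), (fun β => b β t) ⁻¹' Set.Iio L := by
      ext β; simp [P]
    rw [this]
    exact isOpen_iUnion fun t => isOpen_Iio.preimage (hcont t t.2)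
  have hN : IsOpen N := by
    have : N = ⋃ t : Set.Ici (0 : ℝ), (fun β => b β t) ⁻¹' Set.Ioi H := by
      ext β; simp [N]
    rw [this]
    exact isOpen_iUnion fun t => isOpen_Ioi.preimage (hcont t t.2)
  have hLH := h.lt
  by_cases hcov : (Set.univ : Set ℝ) ⊆ P ∪ N
  · obtain ⟨β, -, ⟨s, hs, hsb⟩, ⟨t, ht, htb⟩⟩ := isPreconnected_univ P N hP hN hcov
      ⟨L - 1, trivial, 0, le_rfl, by rw [hb]; linarith⟩
      ⟨H + 1, trivial, 0, le_rfl, by rw [hb]; linarith⟩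
    have h1 := hlow β s (max s t) (le_max_left _ _) hsb
    have h2 := hhigh β t (max s t) (le_max_right _ _) htb
    linarith
  · obtain ⟨β, -, hβ⟩ := Set.not_subset.1 hcov
    refine ⟨u β, a β, b β, ho β, hu β, ha β, fun t ht => ⟨?_, ?_⟩⟩
    · by_contra! hlt; exact hβ (Or.inl ⟨t, ht, hlt⟩)
    · by_contra! hlt; exact hβ (Or.inr ⟨t, ht, hlt⟩)

/-- If `b₂ 0 < b₁ 0`, the two orbits are ordered and `b₁ - b₂` would exceed `H - L`. Equal data give
uniqueness of the shooting value; in general this is its monotonicity. -/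
theorem bounded_orbit_le (h : IsTruncatedFlux F g C L H) (hε : 0 < ε)
    {u₁ a₁ b₁ u₂ a₂ b₂ : ℝ → ℝ} (h₁ : IsOrbit ε F g u₁ a₁ b₁) (h₂ : IsOrbit ε F g u₂ a₂ b₂)
    (hu : u₁ 0 = u₂ 0) (ha : a₁ 0 ≤ a₂ 0) (hb₁ : ∀ t, 0 ≤ t → b₁ t ∈ Set.Icc L H)
    (hb₂ : ∀ t, 0 ≤ t → b₂ t ∈ Set.Icc L H) : b₁ 0 ≤ b₂ 0 := by
  by_contra! hlt
  obtain ⟨t, ht, h3⟩ := h.exists_lt_sub_of_ordered hε h₁ h₂ hu.le (by linarith) hlt (H - L)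
  linarith [(hb₁ t ht).2, (hb₂ t ht).1]

/-- Below this range the initial velocity would lie in the order cone, above it in the opposite
cone. With its reflected version it provides the invariant interval for the fixed point. -/
theorem bounded_orbit_range (h : IsTruncatedFlux F g C L H) (hε : 0 < ε) {u a b : ℝ → ℝ}
    (ho : IsOrbit ε F g u a b) (hb : ∀ t, 0 ≤ t → b t ∈ Set.Icc L H)
    (ha₁ : g (u 0) ≤ a 0) (ha₂ : a 0 ≤ g (u 0) - 2 * F (u 0)) :
    g (u 0) + 2 * F (u 0) ≤ b 0 ∧ b 0 ≤ g (u 0) := by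
  have h1 := h.not_mem_cone hε ho hb (σ := 1) le_rfl
  have h2 := h.not_mem_cone hε ho hb (σ := -1) le_rfl
  constructor
  · by_contra! hlt
    have := h1 (by linarith) (by linarith)
    linarith
  · by_contra! hlt
    by_cases hp : F (u 0) + (a 0 - b 0) / 2 ≤ 0
    · have := h2 (by linarith) (by linarith)
      linarith
    · linarith

/-- Bounded orbits that start with nonpositive velocities `u'` and `a'` stay monotone. -/
theorem bounded_orbit_antitone (h : IsTruncatedFlux F g C L H) (hε : 0 < ε) {u a b : ℝ → ℝ}
    (ho : IsOrbit ε F g u a b) (hb : ∀ t, 0 ≤ t → b t ∈ Set.Icc L H)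
    (hF : F (u 0) ≠ 0) (hp : F (u 0) + (a 0 - b 0) / 2 ≤ 0) (hq : g (u 0) ≤ a 0)
    {t : ℝ} (ht : 0 ≤ t) :
    F (u t) + (a t - b t) / 2 ≤ 0 ∧ g (u t) ≤ a t ∧ b t ≤ g (u t) := by
  have hFu := fun t => (h.hasDerivAt_F (u t)).comp t (ho.hasDerivAt_u t)
  have hgu := fun t => (h.hasDerivAt_g (u t)).comp t (ho.hasDerivAt_u t)
  set p : ℝ → ℝ := fun t => F (u t) + (a t - b t) / 2 with hpdef
  have hpd : ∀ t, HasDerivAt p (deriv F (u t) * (p t / ε) + (2 * g (u t) - a t - b t) / 2) t := by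
    intro t
    refine ((hFu t).add (((ho.hasDerivAt_a t).sub (ho.hasDerivAt_b t)).div_const 2)).congr_deriv ?_
    ring
  have hpc : Continuous p := continuous_iff_continuousAt.2 fun t => (hpd t).continuousAt
  have hqle : ∀ t, 0 ≤ t → (∀ s, 0 ≤ s → s < t → p s ≤ 0) → g (u t) ≤ a t := by
    intro t ht hs
    have hd : ∀ s, HasDerivAt (fun s => (g (u s) - a s) * Real.exp s)
        ((deriv g (u s) * (p s / ε) - (g (u s) - a s)) * Real.exp s
          + (g (u s) - a s) * (Real.exp s)) s := fun s =>
      ((hgu s).sub (ho.hasDerivAt_a s)).mul (Real.hasDerivAt_exp s)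
    have hanti : AntitoneOn (fun s => (g (u s) - a s) * Real.exp s) (Set.Icc 0 t) := by
      refine antitoneOn_of_deriv_nonpos (convex_Icc _ _)
        (fun s _ => (hd s).continuousAt.continuousWithinAt)
        (fun s _ => (hd s).differentiableAt.differentiableWithinAt) (fun s hs' => ?_)
      rw [(hd s).deriv]
      rw [interior_Icc] at hs'
      have h1 : p s / ε ≤ 0 := div_nonpos_of_nonpos_of_nonneg (hs s hs'.1.le hs'.2) hε.le
      have h2 := mul_nonpos_of_nonpos_of_nonneg
        (mul_nonpos_of_nonneg_of_nonpos (h.deriv_g_nonneg (u s)) h1) (Real.exp_pos s).le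
      linarith
    have h1 := hanti ⟨le_rfl, ht⟩ ⟨ht, le_rfl⟩ ht
    simp only [Real.exp_zero, mul_one] at h1
    have h2 : (g (u t) - a t) * Real.exp t ≤ 0 := by linarith
    linarith [nonpos_of_mul_nonpos_left h2 (Real.exp_pos t)]
  have hpall : ∀ t, 0 ≤ t → p t ≤ 0 := by
    -- At the infimum `τ` of the times with `p > 0`, `p` vanishes with nonnegative derivative, while
    -- `a' ≤ 0` still holds.
    by_contra! hcon
    set S : Set ℝ := {t | 0 ≤ t ∧ 0 < p t} with hS
    have hSne : S.Nonempty := hcon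
    have hSbdd : BddBelow S := ⟨0, fun t ht => ht.1⟩
    set τ := sInf S with hτ
    have hτ0 : 0 ≤ τ := le_csInf hSne fun t ht => ht.1
    have hbefore : ∀ s, 0 ≤ s → s < τ → p s ≤ 0 := by
      intro s hs hsτ
      by_contra! hps
      exact absurd (csInf_le hSbdd (show s ∈ S from ⟨hs, hps⟩)) (not_le.2 hsτ)
    have hτle : p τ ≤ 0 := by
      rcases hτ0.eq_or_lt with h0 | h0
      · rw [← h0]; exact hp
      · have : τ ∈ closure (Set.Ico 0 τ) := by
          rw [closure_Ico h0.ne]; exact ⟨hτ0, le_rfl⟩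
        exact closure_minimal (fun s hs => hbefore s hs.1 hs.2)
          (isClosed_le hpc continuous_const) this
    have hτge : 0 ≤ p τ :=
      closure_minimal (fun s (hs : s ∈ S) => hs.2.le) (isClosed_le continuous_const hpc)
        (csInf_mem_closure hSne hSbdd)
    have hpτ : p τ = 0 := le_antisymm hτle hτge
    have hqτ := hqle τ hτ0 hbefore
    have hder : 0 ≤ 2 * g (u τ) - a τ - b τ := by
      by_contra! hneg
      have hd := hpd τ
      rw [hpτ, zero_div, mul_zero, zero_add] at hd
      have hsl := (hasDerivAt_iff_tendsto_slope.1 hd).eventually_lt_const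
        (show (2 * g (u τ) - a τ - b τ) / 2 < 0 by linarith)
      have hsl' := eventually_nhdsWithin_iff.1 hsl
      obtain ⟨δ, hδ, hball⟩ := Metric.eventually_nhds_iff.1 hsl'
      obtain ⟨s, hsS, hsτ⟩ := exists_lt_of_csInf_lt hSne (show sInf S < τ + δ by linarith)
      have h1 : τ ≤ s := csInf_le hSbdd hsS
      have h2 : s ≠ τ := by
        rintro rfl
        exact absurd hsS.2 (not_lt.2 hτle)
      have h3 := hball (show dist s τ < δ by
        rw [Real.dist_eq, abs_of_nonneg (by linarith)]; linarith) h2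
      rw [slope_def_field, hpτ, sub_zero] at h3
      have h4 : 0 < p s / (s - τ) :=
        div_pos hsS.2 (sub_pos.2 (lt_of_le_of_ne h1 h2.symm))
      linarith
    have hpτ' : F (u τ) + (a τ - b τ) / 2 = 0 := hpτ
    -- Cone exclusion gives `b' ≥ 0`, while `b' ≤ a' ≤ 0`: the velocity vanishes at `τ`, and by
    -- uniqueness the whole orbit is an equilibrium, against `hF`.
    have hr := h.not_mem_cone hε ho hb (σ := 1) hτ0 (by linarith) (by linarith)
    have e1 : a τ = g (u τ) := by linarith
    have e2 : b τ = g (u τ) := by linarith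
    have e3 : F (u τ) = 0 := by linarith
    have hconst : IsOrbit ε F g (fun _ => u τ) (fun _ => g (u τ)) (fun _ => g (u τ)) :=
      ⟨fun s => by simpa [e3] using hasDerivAt_const s (u τ),
        fun s => by simpa using hasDerivAt_const s (g (u τ)),
        fun s => by simpa using hasDerivAt_const s (g (u τ))⟩
    have hu := (h.isOrbit_unique ho hconst (t₀ := τ) rfl e1 e2).1
    exact hF (by rw [hu]; exact e3)
  refine ⟨hpall t ht, hqle t ht fun s hs _ => hpall s hs, ?_⟩
  by_contra! hlt
  have hq' := hqle t ht fun s hs _ => hpall s hs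
  have hp' : F (u t) + (a t - b t) / 2 ≤ 0 := hpall t ht
  have := h.not_mem_cone hε ho hb (σ := -1) ht (by linarith) (by linarith)
  linarith

/-! ### Gluing forward and backward orbits -/

/-- A monotone self-map of a real interval has a fixed point. -/
theorem _root_.Monotone.exists_fixedPoint_Icc {ψ : ℝ → ℝ} (hψ : Monotone ψ) {x y : ℝ}
    (hxy : x ≤ y) (hx : x ≤ ψ x) (hy : ψ y ≤ y) : ∃ z ∈ Set.Icc x y, ψ z = z := by
  set S : Set ℝ := {z | z ∈ Set.Icc x y ∧ z ≤ ψ z}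
  have hSx : x ∈ S := ⟨⟨le_rfl, hxy⟩, hx⟩
  have hbdd : BddAbove S := ⟨y, fun z hz => hz.1.2⟩
  have hmem : sSup S ∈ Set.Icc x y := ⟨le_csSup hbdd hSx, csSup_le ⟨x, hSx⟩ fun z hz => hz.1.2⟩
  have hle : sSup S ≤ ψ (sSup S) :=
    csSup_le ⟨x, hSx⟩ fun z hz => hz.2.trans (hψ (le_csSup hbdd hz))
  refine ⟨sSup S, hmem, le_antisymm (le_csSup hbdd ⟨⟨hmem.1.trans hle, ?_⟩, hψ hle⟩) hle⟩
  exact (hψ hmem.2).trans hy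

/-- There is a global orbit through `u = m` along which `u`, `a`, `b` are nonincreasing. -/
theorem exists_antitone_orbit (h : IsTruncatedFlux F g C L H) (hε : 0 < ε) {m : ℝ}
    (hm : F m < 0) :
    ∃ u a b : ℝ → ℝ, IsOrbit ε F g u a b ∧ u 0 = m ∧
      ∀ t, F (u t) + (a t - b t) / 2 ≤ 0 ∧ g (u t) ≤ a t ∧ b t ≤ g (u t) := by
  have h' := h.reflect
  choose u a b ho hu ha hb using fun α => h.exists_bounded_orbit ε m α
  choose u' a' b' ho' hu' ha' hb' using fun α => h'.exists_bounded_orbit ε (-m) α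
  -- `ψ` sends `a 0` to the forward shooting value `b 0`, then to the backward shooting value of `a
  -- 0`. Two order-preserving steps compose, so no continuity is needed.
  set ψ : ℝ → ℝ := fun α => -b' (-b α 0) 0 with hψdef
  have hψ : Monotone ψ := by
    intro α₁ α₂ hα
    have h1 := h.bounded_orbit_le hε (ho α₁) (ho α₂) (by simp [hu]) (by simpa [ha])
      (hb α₁) (hb α₂)
    exact neg_le_neg (h'.bounded_orbit_le hε (ho' (-b α₂ 0)) (ho' (-b α₁ 0)) (by simp [hu'])
      (by simpa [ha']) (hb' _) (hb' _))
  have hrange : ∀ α, g m ≤ α → α ≤ g m - 2 * F m →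
      (g m + 2 * F m ≤ b α 0 ∧ b α 0 ≤ g m) ∧ g m ≤ ψ α ∧ ψ α ≤ g m - 2 * F m := by
    intro α h1 h2
    have h3 := h.bounded_orbit_range hε (ho α) (hb α) (by simpa [hu, ha]) (by simpa [hu, ha])
    simp only [hu] at h3
    have h4 := h'.bounded_orbit_range hε (ho' (-b α 0)) (hb' _)
      (by simp only [hu', ha', neg_neg]; linarith) (by simp only [hu', ha', neg_neg]; linarith)
    simp only [hu', neg_neg] at h4
    refine ⟨h3, ?_, ?_⟩ <;> simp only [hψdef] <;> linarith [h4.1, h4.2]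
  obtain ⟨α, ⟨hα1, hα2⟩, hfix⟩ := hψ.exists_fixedPoint_Icc
    (show g m ≤ g m - 2 * F m by linarith) (hrange _ le_rfl (by linarith)).2.1
    (hrange _ (by linarith) le_rfl).2.2
  obtain ⟨⟨hβ1, hβ2⟩, -⟩ := hrange α hα1 hα2
  have hor := (ho α).reflect
  -- At the fixed point the backward orbit is the reflection of the forward one, so its bound
  -- becomes a bound on `a` for negative times.
  obtain ⟨-, -, e3⟩ := h'.isOrbit_unique (ho' (-b α 0)) hor (t₀ := 0) (by simp [hu, hu'])
    (by simp [ha']) (by simp only [neg_zero, ha]; linarith [show -b' (-b α 0) 0 = α from hfix])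
  have hbr : ∀ t, 0 ≤ t → -a α (-t) ∈ Set.Icc (-H) (-L) := by
    intro t ht
    have := hb' (-b α 0) t ht
    rwa [e3] at this
  -- If `u' 0 > 0`, comparing `b' 0` with `a' 0` puts the velocity in the cone for the orbit or for
  -- its reflection.
  have hp : F m + (α - b α 0) / 2 ≤ 0 := by
    by_contra! hpos
    have h1 := h.not_mem_cone hε (ho α) (hb α) (σ := 1) le_rfl
    have h2 := h'.not_mem_cone hε hor hbr (σ := 1) le_rfl
    simp only [hu, ha, neg_zero, neg_neg] at h1 h2
    rcases le_or_gt (b α 0 - g m) (g m - α) with hqr | hqr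
    · have := h1 (by linarith) (by linarith)
      linarith
    · have := h2 (by linarith) (by linarith)
      linarith
  refine ⟨u α, a α, b α, ho α, hu α, fun t => ?_⟩
  rcases le_total 0 t with ht | ht
  · exact h.bounded_orbit_antitone hε (ho α) (hb α) (by rw [hu]; exact hm.ne)
      (by simpa [hu, ha]) (by simpa [hu, ha]) ht
  · have h1 := h'.bounded_orbit_antitone hε hor hbr (by simpa [hu] using hm.ne)
      (by simp only [hu, ha, neg_zero, neg_neg]; linarith)
      (by simp only [hu, neg_zero, neg_neg]; linarith) (t := -t) (by linarith)
    simp only [neg_neg] at h1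
    refine ⟨by linarith [h1.1], by linarith [h1.2.2], by linarith [h1.2.1]⟩

end IsTruncatedFlux

/-! ### Truncation and limits at infinity -/

/-- A bounded strictly increasing `C¹` function that is the identity on a given interval. -/
theorem exists_contDiff_clamp {lo hi : ℝ} (hlt : lo < hi) :
    ∃ χ : ℝ → ℝ, ContDiff ℝ 1 χ ∧ (∀ s, 0 < deriv χ s ∧ deriv χ s ≤ 1) ∧
      (∀ s ∈ Set.Icc lo hi, χ s = s) ∧ ∀ s, χ s ∈ Set.Icc (lo - 2) (hi + 2) := by
  -- The clamp is `lo + arctan (s - lo)` below `lo` and `hi + arctan (s - hi)` above `hi`; `π / 2 <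
  -- 2` gives the margins.
  set k : ℝ → ℝ := fun t => Real.arctan t - t with hk
  set k' : ℝ → ℝ := fun t => 1 / (1 + t ^ 2) - 1 with hk'
  have hkd : ∀ t, HasDerivAt k (k' t) t := fun t =>
    (Real.hasDerivAt_arctan t).sub (hasDerivAt_id t)
  have hmin := HasDerivAt.comp_min_zero hkd (by simp [hk]) (by simp [hk'])
  have hd : ∀ s, HasDerivAt (fun s => s + k (min (s - lo) 0) - k (min (hi - s) 0))
      (1 + k' (min (s - lo) 0) + k' (min (hi - s) 0)) s := by
    intro s
    have h1 := (hmin (s - lo)).comp s ((hasDerivAt_id s).sub_const lo)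
    have h2 := (hmin (hi - s)).comp s ((hasDerivAt_id s).const_sub hi)
    refine (((hasDerivAt_id s).add h1).sub h2).congr_deriv ?_
    ring
  have hpos : ∀ t : ℝ, 0 < 1 / (1 + t ^ 2) ∧ 1 / (1 + t ^ 2) ≤ 1 := fun t =>
    ⟨by positivity, by rw [div_le_one (by positivity)]; nlinarith [sq_nonneg t]⟩
  have hpi : ∀ t, -2 < Real.arctan t ∧ Real.arctan t < 2 := fun t =>
    ⟨by linarith [Real.neg_pi_div_two_lt_arctan t, Real.pi_lt_four],
      by linarith [Real.arctan_lt_pi_div_two t, Real.pi_lt_four]⟩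
  have hk0 : k 0 = 0 := by simp [hk]
  have hk0' : k' 0 = 0 := by simp [hk']
  refine ⟨_, contDiff_one_iff_deriv.2 ⟨fun s => (hd s).differentiableAt, ?_⟩, fun s => ?_,
    fun s hs => ?_, fun s => ?_⟩
  · have : deriv (fun s => s + k (min (s - lo) 0) - k (min (hi - s) 0)) =
        fun s => 1 + k' (min (s - lo) 0) + k' (min (hi - s) 0) := funext fun s => (hd s).deriv
    rw [this]
    have hkc : Continuous k' := by
      refine Continuous.sub (Continuous.div₀ continuous_const (by fun_prop) fun t => ?_)
        continuous_const
      positivity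
    fun_prop
  · rw [(hd s).deriv]
    rcases le_total lo s with h1 | h1
    · rw [min_eq_right (by linarith : (0 : ℝ) ≤ s - lo), hk0']
      have := hpos (min (hi - s) 0)
      simp only [hk']
      constructor <;> linarith [this.1, this.2]
    · rw [min_eq_right (by linarith : (0 : ℝ) ≤ hi - s), hk0']
      have := hpos (min (s - lo) 0)
      simp only [hk']
      constructor <;> linarith [this.1, this.2]
  · simp only [min_eq_right (sub_nonneg.2 hs.1), min_eq_right (sub_nonneg.2 hs.2), hk0]
    ring
  · rcases le_total lo s with h1 | h1
    · simp only [min_eq_right (sub_nonneg.2 h1), hk0]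
      rcases le_total s hi with h2 | h2
      · simp only [min_eq_right (sub_nonneg.2 h2), hk0]
        constructor <;> linarith
      · simp only [min_eq_left (sub_nonpos.2 h2), hk]
        have := hpi (hi - s)
        constructor <;> linarith [this.1, this.2]
    · simp only [min_eq_right (sub_nonneg.2 (h1.trans hlt.le)), min_eq_left (sub_nonpos.2 h1),
        hk]
      have := hpi (s - lo)
      constructor <;> linarith [this.1, this.2]

/-- If a function and its derivative both converge at `+∞`, the derivative tends to zero. -/
theorem HasDerivAt.limit_eq_zero_of_tendsto_atTop {h h' : ℝ → ℝ} {ℓ d : ℝ}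
    (hh : ∀ t, HasDerivAt h (h' t) t)
    (hℓ : Filter.Tendsto h Filter.atTop (nhds ℓ)) (hd : Filter.Tendsto h' Filter.atTop (nhds d)) :
    d = 0 := by
  have hmvt : ∀ t : ℝ, ∃ ξ, t < ξ ∧ h' ξ = h (t + 1) - h t := by
    intro t
    obtain ⟨ξ, hξ, e⟩ := exists_hasDerivAt_eq_slope h h' (show t < t + 1 by linarith)
      (fun s _ => (hh s).continuousAt.continuousWithinAt) (fun s _ => hh s)
    exact ⟨ξ, hξ.1, by rw [e]; simp⟩
  choose ξ hξ1 hξ2 using hmvt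
  have hξ : Filter.Tendsto ξ Filter.atTop Filter.atTop :=
    Filter.tendsto_atTop_mono (fun t => (hξ1 t).le) Filter.tendsto_id
  have h1 := hd.comp hξ
  have h2 : Filter.Tendsto (h' ∘ ξ) Filter.atTop (nhds (ℓ - ℓ)) := by
    refine ((hℓ.comp (Filter.tendsto_atTop_add_const_right _ 1 Filter.tendsto_id)).sub
      hℓ).congr fun t => ?_
    simp [hξ2]
  rw [sub_self] at h2
  exact tendsto_nhds_unique h1 h2

/-- A bounded nonincreasing orbit converges to an equilibrium at `+∞`. -/
theorem IsOrbit.tendsto_atTop {ε : ℝ} {F g u a b : ℝ → ℝ} (ho : IsOrbit ε F g u a b) (hε : 0 < ε)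
    (hF : Continuous F) (hg : Continuous g) {lo M L : ℝ} (hlo : ∀ t, lo ≤ u t)
    (hM : ∀ s, M ≤ F s) (hL : ∀ s, L ≤ g s)
    (hmono : ∀ t, F (u t) + (a t - b t) / 2 ≤ 0 ∧ g (u t) ≤ a t ∧ b t ≤ g (u t)) :
    ∃ ℓ, F ℓ = 0 ∧ Filter.Tendsto u Filter.atTop (nhds ℓ) ∧
      Filter.Tendsto (fun t => (b t - a t) / 2) Filter.atTop (nhds 0) ∧ ∀ t, ℓ ≤ u t := by
  have hu : Antitone u := antitone_of_hasDerivAt_nonpos ho.hasDerivAt_u fun t =>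
    div_nonpos_of_nonpos_of_nonneg (hmono t).1 hε.le
  have ha : Antitone a := antitone_of_hasDerivAt_nonpos ho.hasDerivAt_a fun t =>
    sub_nonpos.2 (hmono t).2.1
  have hb : Antitone b := antitone_of_hasDerivAt_nonpos ho.hasDerivAt_b fun t =>
    sub_nonpos.2 (hmono t).2.2
  have hal : ∀ t, L ≤ a t := fun t => (hL _).trans (hmono t).2.1
  have hub : BddBelow (Set.range u) := ⟨lo, by rintro _ ⟨t, rfl⟩; exact hlo t⟩
  have hu' := tendsto_atTop_ciInf hu hub
  have ha' := tendsto_atTop_ciInf ha ⟨L, by rintro _ ⟨t, rfl⟩; exact hal t⟩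
  have hb' := tendsto_atTop_ciInf hb ⟨L + 2 * M, by
    rintro _ ⟨t, rfl⟩; linarith [hal t, hM (u t), (hmono t).1]⟩
  generalize (⨅ t, a t) = A at ha'
  generalize (⨅ t, b t) = B at hb'
  have hFu := (hF.tendsto _).comp hu'
  have hgu := (hg.tendsto _).comp hu'
  have e1 := HasDerivAt.limit_eq_zero_of_tendsto_atTop ho.hasDerivAt_u hu'
    ((hFu.add ((ha'.sub hb').div_const 2)).div_const ε)
  have e2 := HasDerivAt.limit_eq_zero_of_tendsto_atTop ho.hasDerivAt_a ha' (hgu.sub ha')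
  have e3 := HasDerivAt.limit_eq_zero_of_tendsto_atTop ho.hasDerivAt_b hb' (hb'.sub hgu)
  refine ⟨_, ?_, hu', ?_, fun t => ciInf_le hub t⟩
  · rw [div_eq_zero_iff] at e1
    rcases e1 with e1 | e1
    · linarith
    · exact absurd e1 hε.ne'
  · have := (hb'.sub ha').div_const 2
    rwa [show (B - A) / 2 = 0 by linarith] at this

/-! ### From profiles to fronts -/

/-- `κ` is the constant of integration of the first equation and `w` a primitive of `v` integrating
the second. Differentiating the first-order system recovers both equations and lifts `u`, `v` from
`C¹` to `C²`. -/
theorem isViscousHamerSolution_of_profile {ε c κ : ℝ} {f g u v w : ℝ → ℝ} (hfg : IsHamerType f g)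
    (hε : ε ≠ 0) (hu : ∀ t, HasDerivAt u ((f (u t) - κ - c * u t - v t) / ε) t)
    (hv : ∀ t, HasDerivAt v (w t - g (u t)) t) (hw : ∀ t, HasDerivAt w (v t) t) :
    IsViscousHamerSolution ε f g (fun t x => u (x - c * t)) (fun t x => v (x - c * t)) := by
  have hf := hfg.contDiff_f
  have hg := hfg.contDiff_g
  have hdu : deriv u = fun t => (f (u t) - κ - c * u t - v t) / ε := funext fun t => (hu t).deriv
  have hdv : deriv v = fun t => w t - g (u t) := funext fun t => (hv t).deriv
  have hdw : deriv w = v := funext fun t => (hw t).deriv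
  have cu : Continuous u := continuous_iff_continuousAt.2 fun t => (hu t).continuousAt
  have cv : Continuous v := continuous_iff_continuousAt.2 fun t => (hv t).continuousAt
  have cw : Continuous w := continuous_iff_continuousAt.2 fun t => (hw t).continuousAt
  have hfd : ∀ s, HasDerivAt f (deriv f s) s := fun s =>
    (hf.differentiable two_ne_zero s).hasDerivAt
  have hgd : ∀ s, HasDerivAt g (deriv g s) s := fun s =>
    (hg.differentiable one_ne_zero s).hasDerivAt
  have cf := hf.continuous
  have cg := hg.continuous
  have u1 : ContDiff ℝ 1 u := contDiff_one_iff_deriv.2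
    ⟨fun t => (hu t).differentiableAt, by rw [hdu]; fun_prop⟩
  have v1 : ContDiff ℝ 1 v := contDiff_one_iff_deriv.2
    ⟨fun t => (hv t).differentiableAt, by rw [hdv]; fun_prop⟩
  have w1 : ContDiff ℝ 1 w := contDiff_one_iff_deriv.2
    ⟨fun t => (hw t).differentiableAt, by rw [hdw]; exact cv⟩
  have f1 : ContDiff ℝ 1 f := hf.of_le one_le_two
  have two : (2 : WithTop ℕ∞) = 1 + 1 := by norm_num
  have u2 : ContDiff ℝ 2 u := by
    rw [two, contDiff_succ_iff_deriv]
    refine ⟨fun t => (hu t).differentiableAt, by simp, ?_⟩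
    rw [hdu]; fun_prop
  have v2 : ContDiff ℝ 2 v := by
    rw [two, contDiff_succ_iff_deriv]
    refine ⟨fun t => (hv t).differentiableAt, by simp, ?_⟩
    rw [hdv]; fun_prop
  have htime : ∀ t x : ℝ, HasDerivAt (fun s => x - c * s) (-c) t := fun t x => by
    simpa using ((hasDerivAt_id t).const_mul c).const_sub x
  have hddu : ∀ t, HasDerivAt (deriv u)
      ((deriv f (u t) * deriv u t - c * deriv u t - deriv v t) / ε) t := by
    intro t
    have h1 := (hfd (u t)).comp t (hu t).differentiableAt.hasDerivAt
    have h2 := (((h1.sub_const κ).sub ((hu t).differentiableAt.hasDerivAt.const_mul c)).sub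
      (hv t).differentiableAt.hasDerivAt).div_const ε
    rw [hdu]
    rw [hdu] at h2
    exact h2
  have hddv : ∀ t, HasDerivAt (deriv v) (v t - deriv g (u t) * deriv u t) t := by
    intro t
    have h1 := (hgd (u t)).comp t (hu t).differentiableAt.hasDerivAt
    rw [hdv]
    exact (hw t).sub h1
  refine ⟨?_, ?_, fun t x => ?_, fun t x => ?_⟩
  · exact u2.comp (contDiff_snd.sub (contDiff_const.mul contDiff_fst))
  · exact v2.comp (contDiff_snd.sub (contDiff_const.mul contDiff_fst))
  · have e1 : deriv (fun s => u (x - c * s)) t = deriv u (x - c * t) * (-c) :=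
      ((hu _).differentiableAt.hasDerivAt.comp t (htime t x)).deriv
    have e2 : deriv (fun y => f (u (y - c * t))) x
        = deriv f (u (x - c * t)) * deriv u (x - c * t) := by
      rw [deriv_comp_sub_const (f := fun y => f (u y))]
      exact ((hfd _).comp _ (hu _).differentiableAt.hasDerivAt).deriv
    have e3 : deriv (fun y => u (y - c * t)) = fun y => deriv u (y - c * t) :=
      funext fun y => deriv_comp_sub_const ..
    have e4 : deriv (fun y => v (y - c * t)) x = deriv v (x - c * t) := deriv_comp_sub_const ..
    rw [e1, e2, e3, e4, deriv_comp_sub_const (f := deriv u), (hddu _).deriv]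
    field_simp
    ring
  · have e2 : deriv (fun y => g (u (y - c * t))) x
        = deriv g (u (x - c * t)) * deriv u (x - c * t) := by
      rw [deriv_comp_sub_const (f := fun y => g (u y))]
      exact ((hgd _).comp _ (hu _).differentiableAt.hasDerivAt).deriv
    have e3 : deriv (fun y => v (y - c * t)) = fun y => deriv v (y - c * t) :=
      funext fun y => deriv_comp_sub_const ..
    rw [e2, e3, deriv_comp_sub_const (f := deriv v), (hddv _).deriv]
    ring

/-- Sign of a strictly convex function vanishing at two points. -/
theorem StrictConvexOn.sign_of_zeros {φ : ℝ → ℝ} (hφ : StrictConvexOn ℝ Set.univ φ) {lo hi : ℝ}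
    (hlt : lo < hi) (hlo : φ lo = 0) (hhi : φ hi = 0) :
    (∀ s, lo < s → s < hi → φ s < 0) ∧ ∀ s, φ s ≤ 0 → s ∈ Set.Icc lo hi := by
  refine ⟨fun s h1 h2 => ?_, fun s hs => ⟨?_, ?_⟩⟩
  · have := hφ.slope_strict_mono_adjacent (Set.mem_univ lo) (Set.mem_univ hi) h1 h2
    rw [hlo, hhi, div_lt_div_iff₀ (by linarith) (by linarith)] at this
    nlinarith
  · by_contra! h1
    have := hφ.slope_strict_mono_adjacent (Set.mem_univ s) (Set.mem_univ hi) h1 hlt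
    rw [hlo, hhi, sub_self, zero_div] at this
    have h3 : 0 ≤ (0 - φ s) / (lo - s) := div_nonneg (by linarith) (by linarith)
    linarith
  · by_contra! h1
    have := hφ.slope_strict_mono_adjacent (Set.mem_univ lo) (Set.mem_univ s) hlt h1
    rw [hlo, hhi, sub_self, zero_div] at this
    have h3 : (φ s - 0) / (s - hi) ≤ 0 := div_nonpos_of_nonpos_of_nonneg (by linarith) (by linarith)
    linarith

/-- Every Lax shock, of whatever amplitude, has a viscous profile. -/
theorem IsHamerType.exists_front {f g : ℝ → ℝ} (hfg : IsHamerType f g) {uminus uplus : ℝ}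
    (hlax : LaxCondition f uminus uplus) {ε : ℝ} (hε : 0 < ε) :
    ∃ u v : ℝ → ℝ, IsPropagatingFront ε f g uminus uplus u v
      (rankineHugoniotSpeed f uminus uplus) := by
  have hf1 : ContDiff ℝ 1 (deriv f) :=
    (contDiff_succ_iff_deriv.1 (show ContDiff ℝ (1 + 1) f by
      rw [one_add_one_eq_two]; exact hfg.contDiff_f)).2.2
  have hlt : uplus < uminus :=
    (strictMono_of_deriv_pos hfg.f_convex).lt_iff_lt.1 (hlax.1.trans hlax.2)
  set c := rankineHugoniotSpeed f uminus uplus with hc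
  set φ : ℝ → ℝ := fun s => f s - (f uminus - c * uminus) - c * s with hφ
  have hφm : φ uminus = 0 := by simp only [hφ]; ring
  have hφp : φ uplus = 0 := by
    have : uplus - uminus ≠ 0 := by linarith
    simp only [hφ, hc, rankineHugoniotSpeed]
    field_simp
    ring
  have hφd : ∀ s, HasDerivAt φ (deriv f s - c) s := by
    intro s
    have h1 := (hfg.contDiff_f.differentiable two_ne_zero s).hasDerivAt
    exact ((h1.sub_const (f uminus - c * uminus)).sub
      ((hasDerivAt_id s).const_mul c)).congr_deriv (by ring)
  have hφ' : deriv φ = fun s => deriv f s - c := funext fun s => (hφd s).deriv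
  have hφ1 : ContDiff ℝ 1 φ := contDiff_one_iff_deriv.2
    ⟨fun s => (hφd s).differentiableAt, by rw [hφ']; exact hf1.continuous.sub continuous_const⟩
  have hφconv : StrictConvexOn ℝ Set.univ φ := by
    refine strictConvexOn_univ_of_deriv2_pos hφ1.continuous fun s => ?_
    simp only [Function.iterate_succ, Function.iterate_zero, Function.comp, id]
    rw [hφ', deriv_sub_const]
    exact hfg.f_convex s
  obtain ⟨hneg, hmem⟩ := hφconv.sign_of_zeros hlt hφp hφm
  obtain ⟨χ, hχ1, hχd, hχid, hχb⟩ := exists_contDiff_clamp hlt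
  have hχmono : StrictMono χ := strictMono_of_deriv_pos fun s => (hχd s).1
  have hgmono : Monotone g := monotone_of_deriv_nonneg
    (hfg.contDiff_g.differentiable one_ne_zero) fun s => (hfg.g_increasing s).le
  have hχpl := hχid uplus ⟨le_rfl, hlt.le⟩
  have hχmi := hχid uminus ⟨hlt.le, le_rfl⟩
  obtain ⟨C₁, hC₁⟩ := (isCompact_Icc (a := uplus - 2) (b := uminus + 2)).exists_bound_of_continuousOn
    (hφ1.continuous_deriv le_rfl).continuousOn
  obtain ⟨C₂, hC₂⟩ := (isCompact_Icc (a := uplus - 2) (b := uminus + 2)).exists_bound_of_continuousOn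
    (hfg.contDiff_g.continuous_deriv le_rfl).continuousOn
  obtain ⟨M, hM⟩ := (isCompact_Icc (a := uplus - 2) (b := uminus + 2)).exists_bound_of_continuousOn
    hφ1.continuous.continuousOn
  have hχdd : ∀ s, HasDerivAt χ (deriv χ s) s := fun s =>
    (hχ1.differentiable one_ne_zero s).hasDerivAt
  have dF : ∀ s, deriv (φ ∘ χ) s = deriv φ (χ s) * deriv χ s := fun s =>
    ((hφd (χ s)).differentiableAt.hasDerivAt.comp s (hχdd s)).deriv
  have dg : ∀ s, deriv (g ∘ χ) s = deriv g (χ s) * deriv χ s := fun s =>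
    ((hfg.contDiff_g.differentiable one_ne_zero (χ s)).hasDerivAt.comp s (hχdd s)).deriv
  -- The unit margins make the bounds on `g ∘ χ` strict.
  have htr : IsTruncatedFlux (φ ∘ χ) (g ∘ χ) (max C₁ C₂) (g (uplus - 2) - 1)
      (g (uminus + 2) + 1) := by
    refine ⟨hφ1.comp hχ1, hfg.contDiff_g.comp hχ1, fun s => ?_, fun s => ?_, fun s => ?_,
      fun s => ?_, fun s => ?_⟩
    · rw [dF, abs_mul, abs_of_pos (hχd s).1]
      have := hC₁ _ (hχb s)
      rw [Real.norm_eq_abs] at this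
      exact le_max_of_le_left ((mul_le_of_le_one_right (abs_nonneg _) (hχd s).2).trans this)
    · rw [dg]; exact mul_nonneg (hfg.g_increasing _).le (hχd s).1.le
    · rw [dg]
      have := (le_abs_self _).trans (hC₂ _ (hχb s))
      exact le_max_of_le_right
        ((mul_le_of_le_one_right (hfg.g_increasing _).le (hχd s).2).trans this)
    · have := hgmono (hχb s).1
      simp only [Function.comp]; linarith
    · have := hgmono (hχb s).2
      simp only [Function.comp]; linarith
  have hmid : uplus < (uplus + uminus) / 2 ∧ (uplus + uminus) / 2 < uminus :=
    ⟨by linarith, by linarith⟩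
  obtain ⟨u, a, b, ho, hu0, hmono⟩ := htr.exists_antitone_orbit hε
    (m := (uplus + uminus) / 2) (by
      rw [Function.comp, hχid _ ⟨hmid.1.le, hmid.2.le⟩]; exact hneg _ hmid.1 hmid.2)
  have hpre : ∀ s, φ (χ s) ≤ 0 → s ∈ Set.Icc uplus uminus := by
    intro s hs
    have h1 := hmem _ hs
    rw [← hχpl, ← hχmi] at h1
    rw [hχpl, hχmi] at h1
    constructor
    · rw [← hχmono.le_iff_le, hχpl]; exact h1.1
    · rw [← hχmono.le_iff_le, hχmi]; exact h1.2
  have hzero : ∀ s, φ (χ s) = 0 → s = uplus ∨ s = uminus := by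
    intro s hs
    have h1 := hpre s hs.le
    rw [hχid s h1] at hs
    by_contra! hcon
    exact (hneg s (lt_of_le_of_ne h1.1 hcon.1.symm) (lt_of_le_of_ne h1.2 hcon.2)).ne hs
  -- Since `b ≤ g(u) ≤ a`, the inequality `u' ≤ 0` forces `φ (χ (u t)) ≤ 0`.
  have humem : ∀ t, u t ∈ Set.Icc uplus uminus := fun t => hpre _ (by
    have := hmono t
    simp only [Function.comp] at this
    linarith [this.1, this.2.1, this.2.2])
  have hMlow : ∀ s, -M ≤ (φ ∘ χ) s := fun s => by
    have := (abs_le.1 (hM _ (hχb s))).1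
    exact this
  have hFc : Continuous (φ ∘ χ) := htr.contDiff_F.continuous
  have hgc : Continuous (g ∘ χ) := htr.contDiff_g.continuous
  obtain ⟨ℓ, hℓ0, hℓu, hℓv, hℓle⟩ := ho.tendsto_atTop hε hFc hgc (fun t => (humem t).1) hMlow
    (fun s => (htr.lt_g s).le) hmono
  obtain ⟨ℓ', hℓ0', hℓu', hℓv', hℓle'⟩ := ho.reflect.tendsto_atTop hε (hFc.comp continuous_neg)
    (hgc.comp continuous_neg).neg (lo := -uminus) (fun t => neg_le_neg (humem _).2)
    (fun s => hMlow (-s)) (fun s => (htr.reflect.lt_g s).le) (fun t => by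
      have := hmono (-t)
      simp only [neg_neg]
      exact ⟨by linarith [this.1], by linarith [this.2.2], by linarith [this.2.1]⟩)
  have hℓ : ℓ = uplus := by
    have := hℓle 0
    rcases hzero ℓ hℓ0 with h1 | h1
    · exact h1
    · linarith [hmid.2]
  have hℓ' : -ℓ' = uminus := by
    have := hℓle' 0
    simp only [neg_zero] at this
    rcases hzero (-ℓ') hℓ0' with h1 | h1
    · linarith [hmid.1]
    · exact h1
  have hφu : ∀ t, (φ ∘ χ) (u t) = φ (u t) := fun t => by
    rw [Function.comp, hχid _ (humem t)]
  have hgu : ∀ t, (g ∘ χ) (u t) = g (u t) := fun t => by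
    rw [Function.comp, hχid _ (humem t)]
  refine ⟨u, fun t => (b t - a t) / 2, isViscousHamerSolution_of_profile
    (κ := f uminus - c * uminus) (v := fun t => (b t - a t) / 2) (w := fun t => (a t + b t) / 2) hfg hε.ne' (fun t => ?_)
    (fun t => ?_) (fun t => ?_), ?_, hℓ ▸ hℓu, ?_, hℓv⟩
  · refine (ho.hasDerivAt_u t).congr_deriv ?_
    rw [hφu]
    simp only [hφ]
    ring
  · refine (((ho.hasDerivAt_b t).sub (ho.hasDerivAt_a t)).div_const 2).congr_deriv ?_
    rw [hgu]
    ring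
  · refine (((ho.hasDerivAt_a t).add (ho.hasDerivAt_b t)).div_const 2).congr_deriv ?_
    ring
  · have := (hℓu'.neg).comp Filter.tendsto_neg_atBot_atTop
    rw [hℓ'] at this
    simpa [Function.comp_def] using this
  · have := hℓv'.comp Filter.tendsto_neg_atBot_atTop
    refine this.congr fun t => ?_
    simp only [Function.comp, neg_neg]
    ring

theorem isHamerType_burgers : IsHamerType (fun s => s ^ 2 / 2) (fun s => s) where
  contDiff_f := by fun_prop
  contDiff_g := contDiff_id
  f_convex s := by
    have : deriv (fun s : ℝ => s ^ 2 / 2) = fun s => s := by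
      funext s; simp
    rw [this]; simp
  g_increasing s := by simp

theorem theorem2 :
    (∀ f g : ℝ → ℝ, IsHamerType f g →
      ∃ δ₀ : ℝ, 0 < δ₀ ∧ ∀ uminus uplus : ℝ, LaxCondition f uminus uplus → |uplus - uminus| < δ₀ →
        ∀ ε : ℝ, 0 < ε → ∃ u v : ℝ → ℝ,
          IsPropagatingFront ε f g uminus uplus u v (rankineHugoniotSpeed f uminus uplus)) ∧
    (∃ δ₀ : ℝ, 0 < δ₀ ∧ ∀ uminus uplus : ℝ, uplus < uminus → |uplus - uminus| < δ₀ →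
      ∀ ε : ℝ, 0 < ε → ∃ u v : ℝ → ℝ,
        IsPropagatingFront ε (fun s => s ^ 2 / 2) (fun s => s) uminus uplus u v
          ((uplus + uminus) / 2)) := by
  -- `1` is an arbitrary positive choice: `exists_front` covers every amplitude.
  refine ⟨fun f g hfg => ⟨1, one_pos, fun um up hlax _ ε hε => hfg.exists_front hlax hε⟩,
    1, one_pos, fun um up hlt _ ε hε => ?_⟩
  have hspeed : rankineHugoniotSpeed (fun s => s ^ 2 / 2) um up = (up + um) / 2 := by
    have : up - um ≠ 0 := by linarith
    simp only [rankineHugoniotSpeed]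
    field_simp
    ring
  have hlax : LaxCondition (fun s => s ^ 2 / 2) um up := by
    rw [LaxCondition, hspeed]
    constructor <;> simp <;> linarith
  rw [← hspeed]
  exact isHamerType_burgers.exists_front hlax hε
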